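/- Let $A$ be a unital $C^*$-algebra and let $X$ be a (right) Hilbert $A$-module, i.e. a right $A$-module with an $A$-valued inner product $\langle\cdot,\cdot\rangle$ that is $\mathbb C$-linear and $A$-linear in the second variable ($\langle x,ya\rangle=\langle x,y\rangle a$), satisfies $\langle y,x\rangle=\langle x,y\rangle^*$ and $\langle x,x\rangle\ge 0$ with equality only for $x=0$, and is complete for the norm $\|x\|=\|\langle x,x\rangle\|^{1/2}$. Let $\{x_j\}_{j\in J}$ be a family of elements of $X$. Call it a frame of $X$ if there is a real constant $C>0$ such that, for every $x\in X$, the sum $\sum_{j\in J}\langle x,x_j\rangle\langle x_j,x\rangle$ (the limit of the net of its finite partial sums) converges in the ultraweak operator topology to some element of the universal enveloping von Neumann algebra $A^{**}$ of $A$ (the double commutant of the image of $A$ under its universal representation, the direct sum of the GNS representations of all states of $A$), and $$C\langle x,x\rangle\le\sum_{j\in J}\langle x,x_j\rangle\langle x_j,x\rangle\le C^{-1}\langle x,x\rangle\quad\text{in } A^{**}.$$ Then $\{x_j\}_{j\in J}$ is a frame of $X$ if and only if there is a real constant $C>0$ such that, for every $x\in X$ and every state $\varphi$ of $A$, the series $\sum_{j\in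 J}\varphi(\langle x,x_j\rangle\langle x_j,x\rangle)$ converges and $$C\,\varphi(\langle x,x\rangle)\le\sum_{j\in J}\varphi(\langle x,x_j\rangle\langle x_j,x\rangle)\le C^{-1}\varphi(\langle x,x\rangle).$$ -/

import Mathlib

open Filter Topology
open scoped ComplexOrder InnerProductSpace

/-- A (right) Hilbert `A`-module over a unital C⋆-algebra `A`: a right `A`-module `X`
(i.e. a module over `Aᵐᵒᵖ`; `MulOpposite.op a • y` is the right multiplication `y a`) with an
`A`-valued inner product, complete for the norm `‖x‖ = ‖⟨x, x⟩‖^(1/2)`.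

(Mathlib's `CStarModule` is not used because its `A`-action is a left one, with
`⟨x, a y⟩ = a ⟨x, y⟩`.) -/
class RightHilbertModule (A X : Type*) [CStarAlgebra A] [PartialOrder A]
    [NormedAddCommGroup X] [Module ℂ X] [Module Aᵐᵒᵖ X] extends Inner A X where
  inner_add_right (x y z : X) : inner x (y + z) = inner x y + inner x z
  inner_smul_right (c : ℂ) (x y : X) : inner x (c • y) = c • inner x y
  inner_op_smul_right (x y : X) (a : A) : inner x (MulOpposite.op a • y) = inner x y * a
  star_inner (x y : X) : star (inner x y) = inner y x
  inner_self_nonneg (x : X) : 0 ≤ inner x x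
  inner_self_eq_zero (x : X) : inner x x = 0 → x = 0
  norm_eq_sqrt_norm_inner_self (x : X) : ‖x‖ = √‖inner x x‖
  complete : CompleteSpace X

section Defs

variable (A : Type*) [CStarAlgebra A] [PartialOrder A]

/-- The states of a unital C⋆-algebra: the positive linear functionals `φ` with `φ 1 = 1`. -/
def CStarState : Type _ := {φ : A →ₚ[ℂ] ℂ // φ 1 = 1}

variable [StarOrderedRing A]

/-- The Hilbert space of the universal representation of `A`: the Hilbert space direct sum of the
Gelfand–Naimark–Segal spaces of all the states of `A`. -/
noncomputable abbrev UniversalSpace : Type _ := lp (fun φ : CStarState A => φ.1.GNS) 2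

variable {A}

theorem norm_gnsStarAlgHom_apply_le (φ : A →ₚ[ℂ] ℂ) (a : A) (v : φ.GNS) :
    ‖φ.gnsStarAlgHom a v‖ ≤ ‖(‖a‖ : ℂ) • v‖ := by
  rw [norm_smul]
  refine (ContinuousLinearMap.le_opNorm _ v).trans ?_
  simpa using mul_le_mul_of_nonneg_right
    (NonUnitalStarAlgHom.norm_apply_le φ.gnsStarAlgHom a) (norm_nonneg v)

/-- The operator of `a` in the universal representation: `(v_φ)_φ ↦ (π_φ(a) v_φ)_φ`, where `π_φ`
is the Gelfand–Naimark–Segal representation of the state `φ`. -/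
noncomputable def universalRepCLM (a : A) : UniversalSpace A →L[ℂ] UniversalSpace A :=
  LinearMap.mkContinuous
    { toFun := fun v => ⟨fun φ => φ.1.gnsStarAlgHom a (v φ),
        (lp.memℓp ((‖a‖ : ℂ) • v)).mono' fun φ => norm_gnsStarAlgHom_apply_le φ.1 a (v φ)⟩
      map_add' := fun v w => by ext φ; exact map_add (φ.1.gnsStarAlgHom a) (v φ) (w φ)
      map_smul' := fun c v => by ext φ; simp }
    ‖a‖ fun v => by
      refine (lp.norm_mono (y := (‖a‖ : ℂ) • v) two_ne_zero
        fun φ => norm_gnsStarAlgHom_apply_le φ.1 a (v φ)).trans ?_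
      rw [norm_smul, Complex.norm_real, norm_norm]

@[simp]
theorem universalRepCLM_apply (a : A) (v : UniversalSpace A) (φ : CStarState A) :
    universalRepCLM a v φ = φ.1.gnsStarAlgHom a (v φ) := rfl

variable (A)

/-- The universal representation of `A`, the direct sum of the Gelfand–Naimark–Segal
representations of all the states of `A`. -/
noncomputable def universalRep : A →⋆ₐ[ℂ] (UniversalSpace A →L[ℂ] UniversalSpace A) where
  toFun := universalRepCLM
  map_one' := by ext v φ; simp
  map_mul' a b := by ext v φ; simp
  map_zero' := by ext v φ; simp
  map_add' a b := by ext v φ; simp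
  commutes' c := by
    ext v φ
    simp [Algebra.algebraMap_eq_smul_one]
  map_star' a := by
    refine (ContinuousLinearMap.eq_adjoint_iff _ _).mpr fun v w => ?_
    simp only [lp.inner_eq_tsum, universalRepCLM_apply, map_star,
      ContinuousLinearMap.star_eq_adjoint, ContinuousLinearMap.adjoint_inner_left]

/-- The universal enveloping von Neumann algebra `A**` of `A`: the double commutant of the image
of the universal representation. -/
noncomputable def universalEnvelopingVonNeumannAlgebra :
    VonNeumannAlgebra (UniversalSpace A) where
  toStarSubalgebra := StarSubalgebra.centralizer ℂ
    (StarSubalgebra.centralizer ℂ (Set.range (universalRep A)) : Set _)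
  centralizer_centralizer' := by
    simp

theorem coe_universalEnvelopingVonNeumannAlgebra :
    (universalEnvelopingVonNeumannAlgebra A : Set (UniversalSpace A →L[ℂ] UniversalSpace A)) =
      Set.centralizer (Set.centralizer (Set.range (universalRep A))) := by
  have h : star (Set.range (universalRep A)) = Set.range (universalRep A) := by
    ext T
    refine ⟨fun ⟨a, ha⟩ => ⟨star a, ?_⟩, fun ⟨a, ha⟩ => ⟨star a, ?_⟩⟩
    · rw [map_star, ha, star_star]
    · rw [map_star, ha]
  simp [universalEnvelopingVonNeumannAlgebra, h, Set.star_centralizer]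

end Defs

/-- The ultraweak operator topology on `B(H)`: the coarsest topology for which all the functionals
`T ↦ ∑ₙ ⟨ηₙ, T ξₙ⟩` with `∑ₙ ‖ξₙ‖² < ∞` and `∑ₙ ‖ηₙ‖² < ∞` are continuous. -/
@[reducible]
noncomputable def ultraweakTopology (H : Type*) [NormedAddCommGroup H] [InnerProductSpace ℂ H] :
    TopologicalSpace (H →L[ℂ] H) :=
  ⨅ (ξ : lp (fun _ : ℕ => H) 2) (η : lp (fun _ : ℕ => H) 2),
    TopologicalSpace.induced (fun T => ∑' n, ⟪η n, T (ξ n)⟫_ℂ) inferInstance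

/-- The family `x` is a frame of the Hilbert `A`-module `X`: for some real `C > 0` and all `y`,
the net of finite partial sums of `∑ⱼ ⟨y, xⱼ⟩ ⟨xⱼ, y⟩` converges in the ultraweak operator topology
to an element `s` of `A**`, and `C ⟨y, y⟩ ≤ s ≤ C⁻¹ ⟨y, y⟩` in `A**` (with `A` mapped to `A**` by
its universal representation, and operators ordered by positivity). -/
def IsHilbertModuleFrame (A : Type*) {X J : Type*} [CStarAlgebra A] [PartialOrder A]
    [StarOrderedRing A] [NormedAddCommGroup X] [Module ℂ X] [Module Aᵐᵒᵖ X]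
    [RightHilbertModule A X] (x : J → X) : Prop :=
  ∃ C : ℝ, 0 < C ∧ ∀ y : X, ∃ s ∈ universalEnvelopingVonNeumannAlgebra A,
    Tendsto (fun F : Finset J => ∑ j ∈ F, universalRep A (⟪y, x j⟫_A * ⟪x j, y⟫_A)) atTop
      (@nhds _ (ultraweakTopology (UniversalSpace A)) s) ∧
    universalRep A (C • ⟪y, y⟫_A) ≤ s ∧ s ≤ universalRep A (C⁻¹ • ⟪y, y⟫_A)

/-! Every state of `A` is a vector state of the universal representation, and conversely every unit
vector there defines a state of `A`. Operator inequalities are tested on unit vectors, so the bounds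
at the level of states are the bounds in `A**`. Convergence costs nothing beyond this: if all states
bound the partial sums of a series of positive elements, these sums form a bounded increasing net of
operators, which converges strongly because `‖T v - S v‖² ≤ ‖B‖ ⟨v, (T - S) v⟩` for
`0 ≤ S ≤ T ≤ B`. Being bounded, it converges ultraweakly, and its limit stays in the von Neumann
algebra `A**`. -/

section UltraweakTopology

variable {ι H : Type*} [NormedAddCommGroup H] [InnerProductSpace ℂ H] {l : Filter ι}
  {T : ι → H →L[ℂ] H} {S : H →L[ℂ] H}

theorem tendsto_ultraweak_iff :
    Tendsto T l (@nhds _ (ultraweakTopology H) S) ↔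
      ∀ ξ η : lp (fun _ : ℕ => H) 2,
        Tendsto (fun i => ∑' n, ⟪η n, T i (ξ n)⟫_ℂ) l (𝓝 (∑' n, ⟪η n, S (ξ n)⟫_ℂ)) := by
  simp only [nhds_iInf, tendsto_iInf, nhds_induced, tendsto_comap_iff, Function.comp_def]

theorem tendsto_inner_of_tendsto_ultraweak (h : Tendsto T l (@nhds _ (ultraweakTopology H) S))
    (v w : H) : Tendsto (fun i => ⟪v, T i w⟫_ℂ) l (𝓝 ⟪v, S w⟫_ℂ) := by
  have tsum_single (R : H →L[ℂ] H) :
      ∑' n, ⟪(lp.single 2 0 v : lp (fun _ : ℕ => H) 2) n,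
        R ((lp.single 2 0 w : lp (fun _ : ℕ => H) 2) n)⟫_ℂ = ⟪v, R w⟫_ℂ := by
    rw [tsum_eq_single 0 fun n hn => by rw [lp.single_apply_ne _ _ _ hn, inner_zero_left]]
    simp only [lp.single_apply_self]
  simpa only [tsum_single] using tendsto_ultraweak_iff.1 h (lp.single 2 0 w) (lp.single 2 0 v)

theorem tendsto_ultraweak_of_norm_le {M : ℝ} (hM : ∀ i, ‖T i‖ ≤ M)
    (h : ∀ v w, Tendsto (fun i => ⟪v, T i w⟫_ℂ) l (𝓝 ⟪v, S w⟫_ℂ)) :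
    Tendsto T l (@nhds _ (ultraweakTopology H) S) := by
  refine tendsto_ultraweak_iff.2 fun ξ η => ?_
  have summable_bound : Summable fun n => ‖η n‖ * (M * ‖ξ n‖) :=
    ((lp.summable_mul (by simpa using Real.HolderConjugate.two_two) η ξ).mul_left M).congr
      fun n => by ring
  refine tendsto_tsum_of_dominated_convergence summable_bound (fun n => h _ _)
    (Eventually.of_forall fun i n => (norm_inner_le_norm _ _).trans ?_)
  gcongr
  exact (T i).le_of_opNorm_le (hM i) _

theorem mem_vonNeumannAlgebra_of_tendsto_ultraweak [CompleteSpace H] [l.NeBot]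
    {M : VonNeumannAlgebra H} (hT : ∀ i, T i ∈ M)
    (h : Tendsto T l (@nhds _ (ultraweakTopology H) S)) : S ∈ M := by
  rw [← M.commutant_commutant, VonNeumannAlgebra.mem_commutant_iff]
  intro R hR
  ext1 w
  refine ext_inner_left ℂ fun v => ?_
  have h_left : Tendsto (fun i => ⟪v, (R * T i) w⟫_ℂ) l (𝓝 ⟪v, (R * S) w⟫_ℂ) := by
    simpa only [mul_apply_eq_comp, ContinuousLinearMap.adjoint_inner_left] using
      tendsto_inner_of_tendsto_ultraweak h (ContinuousLinearMap.adjoint R v) w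
  have h_right : Tendsto (fun i => ⟪v, (T i * R) w⟫_ℂ) l (𝓝 ⟪v, (S * R) w⟫_ℂ) :=
    tendsto_inner_of_tendsto_ultraweak h v (R w)
  refine tendsto_nhds_unique h_left (h_right.congr fun i => ?_)
  rw [VonNeumannAlgebra.mem_commutant_iff.1 hR (T i) (hT i)]

end UltraweakTopology

section UltraweakSum

variable {J H : Type*} [NormedAddCommGroup H] [InnerProductSpace ℂ H] {T : J → H →L[ℂ] H}
  {S : H →L[ℂ] H}

/-- The family of operators `T` sums unconditionally to `S` in the ultraweak operator topology.
This is `HasSum T S` for a topology which is not the instance on `H →L[ℂ] H`. -/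
def HasUltraweakSum (T : J → H →L[ℂ] H) (S : H →L[ℂ] H) : Prop :=
  Tendsto (fun F : Finset J => ∑ j ∈ F, T j) atTop (@nhds _ (ultraweakTopology H) S)

theorem HasUltraweakSum.hasSum_inner (h : HasUltraweakSum T S) (v w : H) :
    HasSum (fun j => ⟪v, T j w⟫_ℂ) ⟪v, S w⟫_ℂ := by
  simpa only [HasSum, SummationFilter.unconditional_filter, sum_apply, inner_sum] using
    tendsto_inner_of_tendsto_ultraweak h v w

theorem HasUltraweakSum.mem_vonNeumannAlgebra [CompleteSpace H] {M : VonNeumannAlgebra H}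
    (h : HasUltraweakSum T S) (hT : ∀ j, T j ∈ M) : S ∈ M :=
  mem_vonNeumannAlgebra_of_tendsto_ultraweak (fun _ => sum_mem fun j _ => hT j) h

end UltraweakSum

section OperatorOrder

variable {H : Type*} [NormedAddCommGroup H] [InnerProductSpace ℂ H] {S T : H →L[ℂ] H}

theorem inner_apply_le_of_le (h : S ≤ T) (v : H) : ⟪v, S v⟫_ℂ ≤ ⟪v, T v⟫_ℂ := by
  have := ContinuousLinearMap.IsPositive.inner_nonneg_right h v
  rwa [sub_apply, inner_sub_right, sub_nonneg] at this

theorem le_of_forall_inner_apply_le (h : ∀ v, ⟪v, S v⟫_ℂ ≤ ⟪v, T v⟫_ℂ) : S ≤ T := by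
  refine (ContinuousLinearMap.isPositive_iff_complex (T - S)).2 fun v => ?_
  have h_nonneg : 0 ≤ ⟪(T - S) v, v⟫_ℂ := by
    rw [← inner_conj_symm, ← RCLike.star_def, star_nonneg_iff, sub_apply, inner_sub_right,
      sub_nonneg]
    exact h v
  obtain ⟨h_re, h_im⟩ := Complex.nonneg_iff.1 h_nonneg
  exact ⟨Complex.ext rfl h_im, h_re⟩

theorem le_of_forall_unit_inner_apply_le (h : ∀ v, ‖v‖ = 1 → ⟪v, S v⟫_ℂ ≤ ⟪v, T v⟫_ℂ) :
    S ≤ T := by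
  refine le_of_forall_inner_apply_le fun v => ?_
  rcases eq_or_ne v 0 with rfl | hv
  · simp
  have inner_eq (R : H →L[ℂ] H) : ⟪v, R v⟫_ℂ =
      (‖v‖ ^ 2 : ℝ) * ⟪(‖v‖⁻¹ : ℂ) • v, R ((‖v‖⁻¹ : ℂ) • v)⟫_ℂ := by
    have : (‖v‖ : ℂ) ≠ 0 := by simpa using hv
    simp only [map_smul, inner_smul_left, inner_smul_right, map_inv₀, Complex.conj_ofReal,
      Complex.ofReal_pow]
    field_simp
  rw [inner_eq S, inner_eq T]
  exact mul_le_mul_of_nonneg_left (h _ (norm_smul_inv_norm hv))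
    (Complex.zero_le_real.2 (by positivity))

variable [CompleteSpace H]

theorem norm_apply_sq_le_of_nonneg (hT : 0 ≤ T) (v : H) :
    ‖T v‖ ^ 2 ≤ ‖T‖ * (⟪v, T v⟫_ℂ).re := by
  obtain ⟨R, rfl⟩ := CStarAlgebra.nonneg_iff_eq_star_mul_self.1 hT
  have inner_eq : (⟪v, (star R * R) v⟫_ℂ).re = ‖R v‖ ^ 2 := by
    rw [mul_apply_eq_comp, ContinuousLinearMap.star_eq_adjoint,
      ContinuousLinearMap.adjoint_inner_right]
    exact inner_self_eq_norm_sq (𝕜 := ℂ) (R v)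
  calc ‖(star R * R) v‖ ^ 2 ≤ (‖star R‖ * ‖R v‖) ^ 2 := by gcongr; exact (star R).le_opNorm (R v)
    _ = ‖star R * R‖ * (⟪v, (star R * R) v⟫_ℂ).re := by
      rw [inner_eq, norm_star, CStarRing.norm_star_mul_self]; ring

theorem norm_apply_sub_apply_sq_le {B : H →L[ℂ] H} (hS : 0 ≤ S) (hST : S ≤ T) (hTB : T ≤ B)
    (v : H) : ‖T v - S v‖ ^ 2 ≤ ‖B‖ * ((⟪v, T v⟫_ℂ).re - (⟪v, S v⟫_ℂ).re) := by
  have h_norm : ‖T - S‖ ≤ ‖B‖ :=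
    CStarAlgebra.norm_le_norm_of_nonneg_of_le (sub_nonneg.2 hST) ((sub_le_self T hS).trans hTB)
  have h_nonneg : 0 ≤ (⟪v, (T - S) v⟫_ℂ).re :=
    ContinuousLinearMap.IsPositive.re_inner_nonneg_right hST v
  calc ‖T v - S v‖ ^ 2 ≤ ‖T - S‖ * (⟪v, (T - S) v⟫_ℂ).re :=
        norm_apply_sq_le_of_nonneg (sub_nonneg.2 hST) v
    _ ≤ ‖B‖ * (⟪v, (T - S) v⟫_ℂ).re := by gcongr
    _ = ‖B‖ * ((⟪v, T v⟫_ℂ).re - (⟪v, S v⟫_ℂ).re) := by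
      rw [sub_apply, inner_sub_right, Complex.sub_re]

variable {ι : Type*} [SemilatticeSup ι] [Nonempty ι] {T : ι → H →L[ℂ] H} {B : H →L[ℂ] H}

theorem cauchySeq_apply_of_monotone (hT : Monotone T) (h_nonneg : ∀ i, 0 ≤ T i)
    (h_le : ∀ i, T i ≤ B) (v : H) : CauchySeq fun i => T i v := by
  have re_inner_mono {S S' : H →L[ℂ] H} (h : S ≤ S') : (⟪v, S v⟫_ℂ).re ≤ (⟪v, S' v⟫_ℂ).re :=
    (Complex.le_def.1 (inner_apply_le_of_le h v)).1
  have h_cauchy : CauchySeq fun i => (⟪v, T i v⟫_ℂ).re :=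
    (tendsto_atTop_ciSup (fun i j hij => re_inner_mono (hT hij))
      ⟨(⟪v, B v⟫_ℂ).re, Set.forall_mem_range.2 fun i => re_inner_mono (h_le i)⟩).cauchySeq
  refine Metric.cauchySeq_iff'.2 fun ε hε => ?_
  obtain ⟨N, hN⟩ := Metric.cauchySeq_iff'.1 h_cauchy (ε ^ 2 / (‖B‖ + 1)) (by positivity)
  refine ⟨N, fun n hn => ?_⟩
  have h_diff : (⟪v, T n v⟫_ℂ).re - (⟪v, T N v⟫_ℂ).re < ε ^ 2 / (‖B‖ + 1) :=
    (le_abs_self _).trans_lt (hN n hn)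
  have h_diff_nonneg := sub_nonneg.2 (re_inner_mono (hT hn))
  rw [dist_eq_norm]
  refine lt_of_pow_lt_pow_left₀ 2 hε.le ?_
  calc ‖T n v - T N v‖ ^ 2 ≤ ‖B‖ * ((⟪v, T n v⟫_ℂ).re - (⟪v, T N v⟫_ℂ).re) :=
        norm_apply_sub_apply_sq_le (h_nonneg N) (hT hn) (h_le n) v
    _ ≤ (‖B‖ + 1) * ((⟪v, T n v⟫_ℂ).re - (⟪v, T N v⟫_ℂ).re) := by gcongr; linarith
    _ < (‖B‖ + 1) * (ε ^ 2 / (‖B‖ + 1)) := by gcongr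
    _ = ε ^ 2 := by field_simp

theorem exists_tendsto_ultraweak_of_monotone (hT : Monotone T) (h_nonneg : ∀ i, 0 ≤ T i)
    (h_le : ∀ i, T i ≤ B) :
    ∃ S, Tendsto T atTop (@nhds _ (ultraweakTopology H) S) := by
  have h_norm (i : ι) : ‖T i‖ ≤ ‖B‖ :=
    CStarAlgebra.norm_le_norm_of_nonneg_of_le (h_nonneg i) (h_le i)
  choose S hS using fun v =>
    cauchySeq_tendsto_of_complete (cauchySeq_apply_of_monotone hT h_nonneg h_le v)
  have h_bounded : Bornology.IsBounded (Set.range T) :=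
    isBounded_iff_forall_norm_le.2 ⟨‖B‖, Set.forall_mem_range.2 h_norm⟩
  exact ⟨.ofTendstoOfBoundedRange S T (tendsto_pi_nhds.2 hS) h_bounded,
    tendsto_ultraweak_of_norm_le h_norm fun v w => tendsto_const_nhds.inner (hS w)⟩

theorem exists_hasUltraweakSum_of_nonneg {J : Type*} {T : J → H →L[ℂ] H} (hT : ∀ j, 0 ≤ T j)
    (h_le : ∀ F : Finset J, ∑ j ∈ F, T j ≤ B) : ∃ S, HasUltraweakSum T S := by
  classical
  exact exists_tendsto_ultraweak_of_monotone
    (fun F G hFG => Finset.sum_le_sum_of_subset_of_nonneg hFG fun j _ _ => hT j)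
    (fun F => Finset.sum_nonneg fun j _ => hT j) h_le

end OperatorOrder

section States

variable {A : Type*} [CStarAlgebra A] [PartialOrder A] [StarOrderedRing A]

section Representation

variable {H : Type*} [NormedAddCommGroup H] [InnerProductSpace ℂ H] [CompleteSpace H]
  (π : A →⋆ₐ[ℂ] (H →L[ℂ] H))

/-- The vector state `a ↦ ⟨v, π(a) v⟩` of the representation `π` given by a unit vector `v`. -/
noncomputable def vectorState (v : H) (hv : ‖v‖ = 1) : CStarState A :=
  ⟨PositiveLinearMap.mk₀
    { toFun := fun a => ⟪v, π a v⟫_ℂ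
      map_add' := fun a b => by simp only [map_add, add_apply, inner_add_right]
      map_smul' := fun c a => by
        simp only [map_smul, smul_apply, inner_smul_right, smul_eq_mul, RingHom.id_apply] }
    fun _ ha => ((ContinuousLinearMap.nonneg_iff_isPositive _).1
      (map_nonneg π ha)).inner_nonneg_right v, by
    change ⟪v, π 1 v⟫_ℂ = 1
    rw [map_one, one_apply_eq_self, inner_self_eq_norm_sq_to_K, hv]
    simp⟩

theorem vectorState_apply (v : H) (hv : ‖v‖ = 1) (a : A) :
    (vectorState π v hv).1 a = ⟪v, π a v⟫_ℂ := rfl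

theorem map_le_map_of_forall_state_le {a b : A} (h : ∀ φ : CStarState A, φ.1 a ≤ φ.1 b) :
    π a ≤ π b :=
  le_of_forall_unit_inner_apply_le fun v hv => h (vectorState π v hv)

variable {J : Type*} {b : J → A} {c d : A}

theorem exists_hasUltraweakSum_of_forall_state (hb : ∀ j, 0 ≤ b j)
    (h : ∀ φ : CStarState A, Summable (fun j => φ.1 (b j)) ∧
      φ.1 c ≤ ∑' j, φ.1 (b j) ∧ ∑' j, φ.1 (b j) ≤ φ.1 d) :
    ∃ s, HasUltraweakSum (fun j => π (b j)) s ∧ π c ≤ s ∧ s ≤ π d := by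
  have sum_le (F : Finset J) : ∑ j ∈ F, π (b j) ≤ π d := by
    rw [← map_sum]
    refine map_le_map_of_forall_state_le π fun φ => ?_
    obtain ⟨h_summable, -, h_le⟩ := h φ
    rw [map_sum]
    exact (h_summable.sum_le_tsum F fun j _ => φ.1.map_nonneg (hb j)).trans h_le
  obtain ⟨s, hs⟩ := exists_hasUltraweakSum_of_nonneg (fun j => map_nonneg π (hb j)) sum_le
  have inner_eq (v : H) (hv : ‖v‖ = 1) : ⟪v, s v⟫_ℂ = ∑' j, (vectorState π v hv).1 (b j) :=
    (hs.hasSum_inner v v).tsum_eq.symm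
  refine ⟨s, hs, le_of_forall_unit_inner_apply_le fun v hv => ?_,
    le_of_forall_unit_inner_apply_le fun v hv => ?_⟩
  · rw [inner_eq v hv, ← vectorState_apply π v hv]
    exact (h _).2.1
  · rw [inner_eq v hv, ← vectorState_apply π v hv]
    exact (h _).2.2

end Representation

open Classical in
/-- The unit vector of the universal representation whose vector state is `φ`: the class of `1` in
the Gelfand–Naimark–Segal summand of `φ`. -/
noncomputable def cyclicVector (φ : CStarState A) : UniversalSpace A :=
  lp.single 2 φ ((φ.1.toPreGNS 1 : φ.1.PreGNS) : φ.1.GNS)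

theorem inner_universalRep_cyclicVector (φ : CStarState A) (a : A) :
    ⟪cyclicVector φ, universalRep A a (cyclicVector φ)⟫_ℂ = φ.1 a := by
  classical
  rw [cyclicVector, lp.inner_single_left]
  change ⟪_, universalRepCLM a _ φ⟫_ℂ = _
  rw [universalRepCLM_apply, lp.single_apply_self]
  simp [PositiveLinearMap.preGNS_inner_def]

theorem universalRep_mem_universalEnvelopingVonNeumannAlgebra (a : A) :
    universalRep A a ∈ universalEnvelopingVonNeumannAlgebra A := by
  rw [← SetLike.mem_coe, coe_universalEnvelopingVonNeumannAlgebra]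
  exact Set.subset_centralizer_centralizer ⟨a, rfl⟩

variable {J : Type*} {b : J → A} {c d : A}

theorem forall_state_of_hasUltraweakSum_universalRep {s : UniversalSpace A →L[ℂ] UniversalSpace A}
    (hs : HasUltraweakSum (fun j => universalRep A (b j)) s) (hcs : universalRep A c ≤ s)
    (hsd : s ≤ universalRep A d) (φ : CStarState A) :
    Summable (fun j => φ.1 (b j)) ∧ φ.1 c ≤ ∑' j, φ.1 (b j) ∧ ∑' j, φ.1 (b j) ≤ φ.1 d := by
  have h_sum := hs.hasSum_inner (cyclicVector φ) (cyclicVector φ)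
  have h_lower := inner_apply_le_of_le hcs (cyclicVector φ)
  have h_upper := inner_apply_le_of_le hsd (cyclicVector φ)
  simp only [inner_universalRep_cyclicVector] at h_sum h_lower h_upper
  exact ⟨h_sum.summable, h_sum.tsum_eq ▸ h_lower, h_sum.tsum_eq ▸ h_upper⟩

theorem exists_hasUltraweakSum_universalRep_iff (hb : ∀ j, 0 ≤ b j) :
    (∃ s ∈ universalEnvelopingVonNeumannAlgebra A,
      HasUltraweakSum (fun j => universalRep A (b j)) s ∧
      universalRep A c ≤ s ∧ s ≤ universalRep A d) ↔
    ∀ φ : CStarState A, Summable (fun j => φ.1 (b j)) ∧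
      φ.1 c ≤ ∑' j, φ.1 (b j) ∧ ∑' j, φ.1 (b j) ≤ φ.1 d := by
  refine ⟨fun ⟨s, _, hs, hcs, hsd⟩ => forall_state_of_hasUltraweakSum_universalRep hs hcs hsd,
    fun h => ?_⟩
  obtain ⟨s, hs, h_bounds⟩ := exists_hasUltraweakSum_of_forall_state (universalRep A) hb h
  exact ⟨s, hs.mem_vonNeumannAlgebra fun j =>
    universalRep_mem_universalEnvelopingVonNeumannAlgebra (b j), hs, h_bounds⟩

end States

theorem proposition3p1_general {A X J : Type*} [CStarAlgebra A] [PartialOrder A]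
    [StarOrderedRing A] [Inner A X] (star_inner : ∀ y z : X, star ⟪y, z⟫_A = ⟪z, y⟫_A)
    (x : J → X) :
    (∃ C : ℝ, 0 < C ∧ ∀ y : X, ∃ s ∈ universalEnvelopingVonNeumannAlgebra A,
      HasUltraweakSum (fun j => universalRep A (⟪y, x j⟫_A * ⟪x j, y⟫_A)) s ∧
      universalRep A (C • ⟪y, y⟫_A) ≤ s ∧ s ≤ universalRep A (C⁻¹ • ⟪y, y⟫_A)) ↔
      ∃ C : ℝ, 0 < C ∧ ∀ (y : X) (φ : CStarState A),
        Summable (fun j => φ.1 (⟪y, x j⟫_A * ⟪x j, y⟫_A)) ∧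
        C * φ.1 ⟪y, y⟫_A ≤ ∑' j, φ.1 (⟪y, x j⟫_A * ⟪x j, y⟫_A) ∧
        ∑' j, φ.1 (⟪y, x j⟫_A * ⟪x j, y⟫_A) ≤ C⁻¹ * φ.1 ⟪y, y⟫_A := by
  have h_nonneg (y : X) (j : J) : 0 ≤ ⟪y, x j⟫_A * ⟪x j, y⟫_A := by
    rw [← star_inner (x j) y]
    exact star_mul_self_nonneg _
  refine exists_congr fun C => and_congr_right fun _ => forall_congr' fun y => ?_
  rw [exists_hasUltraweakSum_universalRep_iff (h_nonneg y)]
  simp only [PositiveLinearMap.map_smul_of_tower, Complex.real_smul, Complex.ofReal_inv]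

theorem proposition3p1 {A X J : Type*} [CStarAlgebra A] [PartialOrder A] [StarOrderedRing A]
    [NormedAddCommGroup X] [Module ℂ X] [Module Aᵐᵒᵖ X] [RightHilbertModule A X] (x : J → X) :
    IsHilbertModuleFrame A x ↔
      ∃ C : ℝ, 0 < C ∧ ∀ (y : X) (φ : CStarState A),
        Summable (fun j => φ.1 (⟪y, x j⟫_A * ⟪x j, y⟫_A)) ∧
        C * φ.1 ⟪y, y⟫_A ≤ ∑' j, φ.1 (⟪y, x j⟫_A * ⟪x j, y⟫_A) ∧
        ∑' j, φ.1 (⟪y, x j⟫_A * ⟪x j, y⟫_A) ≤ C⁻¹ * φ.1 ⟪y, y⟫_A :=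
  proposition3p1_general RightHilbertModule.star_inner x
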